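/- Let $(L_k)_{k\ge 1}$ be independent real random variables on a probability space, each with the Laplace distribution of density $\tfrac12 e^{-|x|}$, $x\in\mathbb{R}$. Then the series $$L_0=\sum_{k=1}^{\infty}\frac{L_k}{(2k-1)\pi}$$ converges almost surely (as the limit of its partial sums), and its sum $L_0$ follows the hyperbolic secant distribution with density $$f_{L_0}(x)=\operatorname{sech}(\pi x)=\frac{1}{\cosh(\pi x)},\qquad x\in\mathbb{R},$$ with respect to Lebesgue measure. -/

import Mathlib

open MeasureTheory ProbabilityTheory Filter Topology

noncomputable section

/-- The standard Laplace distribution on `ℝ`: density `(1/2) exp (-|x|)` with respect to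
Lebesgue measure. -/
def laplaceMeasure : Measure ℝ :=
  volume.withDensity (fun x => ENNReal.ofReal ((1 / 2) * Real.exp (-|x|)))

/-- The hyperbolic secant. -/
def sech (x : ℝ) : ℝ := 1 / Real.cosh x

/-- The hyperbolic secant distribution with density `sech (π x)` with respect to Lebesgue
measure. -/
def sechMeasure : Measure ℝ :=
  volume.withDensity (fun x => ENNReal.ofReal (sech (Real.pi * x)))

/-- The sum of the first `n` terms of the series `∑_{k ≥ 1} L_k / ((2 k - 1) π)`. The variables
are numbered from `0`: `L k` is the variable called `L_{k+1}` in the series. -/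
def secantPartialSum {Ω : Type*} (L : ℕ → Ω → ℝ) (n : ℕ) (ω : Ω) : ℝ :=
  ∑ k ∈ Finset.range n, L k ω / ((2 * (k : ℝ) + 1) * Real.pi)

end

/-! The terms are independent and centered, with variances a constant over `(2k-1)^2`, so their
partial sums form an L²-bounded martingale and converge almost surely. The law of the sum is found
by Fourier transform. A Laplace variable has characteristic function `1 / (1 + t^2)`, so the partial
sums have `∏ (1 + (t / ((2k-1)π))^2)⁻¹`, which tends to `1 / cosh (t/2)` by Euler's product
(`tendsto_euler_cosh_prod`). This is the transform of `sech (π x)`, computed through the Beta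
integral and the reflection formula (`integral_sech_smul_exp`). Dominated convergence and uniqueness
of characteristic functions conclude. -/

/-! ### Almost sure convergence of series of independent variables -/

/-- If independent centered square-integrable variables have summable variances, then the partial
sums of their series converge almost surely; auxiliary version for strongly measurable variables. -/
theorem ae_exists_tendsto_sum_of_summable_variance_of_stronglyMeasurable {Ω : Type*}
    [MeasurableSpace Ω] {P : Measure Ω} [IsProbabilityMeasure P] {X : ℕ → Ω → ℝ}
    (hm : ∀ k, StronglyMeasurable (X k)) (hX : ∀ k, MemLp (X k) 2 P)
    (h0 : ∀ k, ∫ ω, X k ω ∂P = 0) (hind : iIndepFun X P)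
    (hs : Summable fun k => Var[X k; P]) :
    ∀ᵐ ω ∂P, ∃ l : ℝ, Tendsto (fun n => ∑ k ∈ Finset.range n, X k ω) atTop (𝓝 l) := by
  -- The natural filtration at time `n` already contains `X n`, so `M n` includes that term and its
  -- next increment is `X (n + 1)`.
  set M : ℕ → Ω → ℝ := fun n => ∑ k ∈ Finset.range (n + 1), X k with hM
  have hint : ∀ k, Integrable (X k) P := fun k => (hX k).integrable (by norm_num)
  have hML : ∀ n, MemLp (M n) 2 P := fun n => memLp_finsetSum' _ fun k _ => hX k
  have hMint : ∀ n, Integrable (M n) P := fun n => (hML n).integrable (by norm_num)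
  have hmart : Martingale M (Filtration.natural X hm) P := by
    refine martingale_of_condExp_sub_eq_zero_nat ?_ hMint ?_
    · intro n
      refine Finset.stronglyMeasurable_sum _ fun k hk => ?_
      exact (Filtration.stronglyAdapted_natural hm k).mono
        ((Filtration.natural X hm).mono (Nat.lt_succ_iff.mp (Finset.mem_range.mp hk)))
    · intro n
      have : M (n + 1) - M n = X (n + 1) := by
        simp only [hM, Finset.sum_range_succ _ (n + 1), add_sub_cancel_left]
      rw [this]
      filter_upwards [hind.condExp_natural_ae_eq_of_lt hm (Nat.lt_succ_self n)] with ω hω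
      simpa [h0] using hω
  have hmean : ∀ n, ∫ ω, M n ω ∂P = 0 := by
    intro n
    simp only [hM, Finset.sum_apply]
    rw [integral_finsetSum _ fun k _ => hint k]
    simp [h0]
  have hvar : ∀ n, ∫ ω, M n ω ^ 2 ∂P ≤ ∑' k, Var[X k; P] := by
    intro n
    rw [← variance_of_integral_eq_zero (hML n).aemeasurable (hmean n), hM,
      IndepFun.variance_sum (fun k _ => hX k) fun i _ j _ hij => hind.indepFun hij]
    exact hs.sum_le_tsum _ fun k _ => variance_nonneg _ _
  -- The martingale convergence theorem wants an L¹ bound; `|m| ≤ 1 + m ^ 2` derives it from the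
  -- variances.
  have hbdd : ∀ n, eLpNorm (M n) 1 P ≤ (1 + ∑' k, Var[X k; P]).toNNReal := by
    intro n
    rw [eLpNorm_one_eq_lintegral_enorm, ← ofReal_integral_norm_eq_lintegral_enorm (hMint n)]
    refine ENNReal.ofReal_le_ofReal ?_
    calc ∫ ω, ‖M n ω‖ ∂P ≤ ∫ ω, (1 + M n ω ^ 2) ∂P := by
          refine integral_mono (hMint n).norm ((integrable_const _).add (hML n).integrable_sq) ?_
          intro ω
          change |M n ω| ≤ 1 + M n ω ^ 2
          nlinarith [sq_abs (M n ω), sq_nonneg (|M n ω| - 1), abs_nonneg (M n ω)]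
      _ = 1 + ∫ ω, M n ω ^ 2 ∂P := by
          rw [integral_add (integrable_const _) (hML n).integrable_sq]
          simp
      _ ≤ _ := by linarith [hvar n]
  filter_upwards [hmart.submartingale.exists_ae_tendsto_of_bdd hbdd] with ω ⟨l, hl⟩
  refine ⟨l, (tendsto_add_atTop_iff_nat 1).mp ?_⟩
  simpa [hM] using hl

/-- If independent centered square-integrable variables have summable variances, then the partial
sums of their series converge almost surely. -/
theorem ae_exists_tendsto_sum_of_summable_variance {Ω : Type*}
    [MeasurableSpace Ω] {P : Measure Ω} [IsProbabilityMeasure P] {X : ℕ → Ω → ℝ}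
    (hX : ∀ k, MemLp (X k) 2 P) (h0 : ∀ k, ∫ ω, X k ω ∂P = 0) (hind : iIndepFun X P)
    (hs : Summable fun k => Var[X k; P]) :
    ∀ᵐ ω ∂P, ∃ l : ℝ, Tendsto (fun n => ∑ k ∈ Finset.range n, X k ω) atTop (𝓝 l) := by
  have hae : ∀ k, X k =ᵐ[P] (hX k).1.mk (X k) := fun k => (hX k).1.ae_eq_mk
  have key := ae_exists_tendsto_sum_of_summable_variance_of_stronglyMeasurable (P := P)
    (X := fun k => (hX k).1.mk (X k)) (fun k => (hX k).1.stronglyMeasurable_mk)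
    (fun k => (memLp_congr_ae (hae k)).mp (hX k))
    (fun k => (integral_congr_ae (hae k)).symm.trans (h0 k)) (hind.congr hae)
    (hs.congr fun k => variance_congr (hae k))
  filter_upwards [key, ae_all_iff.mpr hae] with ω hω hω'
  simpa only [hω'] using hω

/-! ### The Laplace distribution -/

theorem integral_laplaceMeasure {E : Type*} [NormedAddCommGroup E] [NormedSpace ℝ E] (g : ℝ → E) :
    ∫ x, g x ∂laplaceMeasure = ∫ x, ((1 / 2) * Real.exp (-|x|)) • g x := by
  rw [laplaceMeasure, integral_withDensity_eq_integral_toReal_smul (by fun_prop)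
      (ae_of_all _ fun _ => ENNReal.ofReal_lt_top)]
  refine integral_congr_ae (ae_of_all _ fun x => ?_)
  simp only
  rw [ENNReal.toReal_ofReal (by positivity)]

theorem charFun_laplaceMeasure (t : ℝ) :
    charFun laplaceMeasure t = ((1 / (1 + t ^ 2) : ℝ) : ℂ) := by
  set a : ℂ := -1 + t * Complex.I with ha
  set b : ℂ := 1 + t * Complex.I with hb
  have hare : a.re < 0 := by simp [ha]
  have hbre : 0 < b.re := by simp [hb]
  have ha0 : a ≠ 0 := fun h => by simp [h] at hare
  have hb0 : b ≠ 0 := fun h => by simp [h] at hbre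
  set g : ℝ → ℂ := fun x => ((1 / 2) * Real.exp (-|x|)) • Complex.exp (t * x * Complex.I) with hg
  have e1 : Set.EqOn g (fun x : ℝ => (1 / 2 : ℂ) * Complex.exp (b * x)) (Set.Iic 0) := by
    intro x hx
    simp only [hg, abs_of_nonpos (Set.mem_Iic.mp hx), neg_neg, Complex.real_smul]
    push_cast
    rw [mul_assoc, ← Complex.exp_add]
    congr 2
    rw [hb]; ring
  have e2 : Set.EqOn g (fun x : ℝ => (1 / 2 : ℂ) * Complex.exp (a * x)) (Set.Ioi 0) := by
    intro x hx
    simp only [hg, abs_of_pos (Set.mem_Ioi.mp hx), Complex.real_smul]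
    push_cast
    rw [mul_assoc, ← Complex.exp_add]
    congr 2
    rw [ha]; ring
  have i1 : IntegrableOn g (Set.Iic 0) :=
    (integrableOn_congr_fun e1 measurableSet_Iic).mpr
      ((integrableOn_exp_mul_complex_Iic hbre 0).const_mul _)
  have i2 : IntegrableOn g (Set.Ioi 0) :=
    (integrableOn_congr_fun e2 measurableSet_Ioi).mpr
      ((integrableOn_exp_mul_complex_Ioi hare 0).const_mul _)
  rw [charFun_apply_real, integral_laplaceMeasure]
  change ∫ x, g x = _
  rw [← intervalIntegral.integral_Iic_add_Ioi i1 i2, setIntegral_congr_fun measurableSet_Iic e1,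
    setIntegral_congr_fun measurableSet_Ioi e2, integral_const_mul, integral_const_mul,
    integral_exp_mul_complex_Iic hbre, integral_exp_mul_complex_Ioi hare]
  have hab : a * b = -(1 + t ^ 2) := by
    rw [ha, hb]; ring_nf; rw [Complex.I_sq]; ring
  have hd : a - b = -2 := by rw [ha, hb]; ring
  have hne : (1 + (t : ℂ) ^ 2) ≠ 0 := by
    rw [← neg_ne_zero, ← hab]; exact mul_ne_zero ha0 hb0
  have : 1 / 2 * (Complex.exp (b * (0 : ℝ)) / b) + 1 / 2 * (-Complex.exp (a * (0 : ℝ)) / a)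
      = (a - b) / (2 * (a * b)) := by
    simp only [Complex.ofReal_zero, mul_zero, Complex.exp_zero]
    field_simp
    ring
  rw [this, hab, hd]
  push_cast
  field_simp

theorem integral_id_laplaceMeasure : ∫ x, x ∂laplaceMeasure = 0 := by
  rw [integral_laplaceMeasure]
  have h := integral_neg_eq_self (fun x : ℝ => ((1 / 2) * Real.exp (-|x|)) • x) volume
  simp only [abs_neg, smul_neg, integral_neg] at h
  linarith

theorem memLp_id_laplaceMeasure : MemLp id 2 laplaceMeasure := by
  rw [memLp_two_iff_integrable_sq aestronglyMeasurable_id, laplaceMeasure,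
    integrable_withDensity_iff (by fun_prop)
      (ae_of_all _ fun _ => ENNReal.ofReal_lt_top)]
  have hexp : Integrable fun x : ℝ => Real.exp (-(1 / 2) * |x|) := by
    rw [← integrableOn_univ, ← Set.Iic_union_Ioi (a := (0 : ℝ)), integrableOn_union]
    constructor
    · refine (integrableOn_congr_fun (fun x hx => ?_) measurableSet_Iic).mpr
        (integrableOn_exp_mul_Iic (a := 1 / 2) (by norm_num) 0)
      simp only [abs_of_nonpos (Set.mem_Iic.mp hx)]
      ring_nf
    · refine (integrableOn_congr_fun (fun x hx => ?_) measurableSet_Ioi).mpr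
        (integrableOn_exp_mul_Ioi (a := -(1 / 2)) (by norm_num) 0)
      simp only [abs_of_pos (Set.mem_Ioi.mp hx)]
  refine (hexp.const_mul 4).mono' (by fun_prop) (ae_of_all _ fun x => ?_)
  rw [ENNReal.toReal_ofReal (by positivity), Real.norm_of_nonneg (by positivity)]
  -- With `u = |x| / 2`, the bound `u ^ 2 / 2 ≤ exp u` costs half of the decay of `exp (-|x|)` and
  -- leaves the integrable majorant `4 * exp (-|x| / 2)`.
  have h := Real.quadratic_le_exp_of_nonneg (x := |x| / 2) (by positivity)
  have he : Real.exp (-|x|) = Real.exp (-(1 / 2) * |x|) * Real.exp (-(1 / 2) * |x|) := by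
    rw [← Real.exp_add]; ring_nf
  have he' : Real.exp (-(1 / 2) * |x|) * Real.exp (|x| / 2) = 1 := by
    rw [← Real.exp_add]; ring_nf; exact Real.exp_zero
  have hpos := Real.exp_pos (-(1 / 2) * |x|)
  have hx : x ^ 2 ≤ 8 * Real.exp (|x| / 2) := by
    have := sq_abs x
    have := abs_nonneg x
    nlinarith
  simp only [id]
  calc x ^ 2 * (1 / 2 * Real.exp (-|x|))
      ≤ 8 * Real.exp (|x| / 2) * (1 / 2 * Real.exp (-|x|)) := by gcongr
    _ = 4 * (Real.exp (-(1 / 2) * |x|) * Real.exp (|x| / 2)) * Real.exp (-(1 / 2) * |x|) := by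
        rw [he]; ring
    _ = _ := by rw [he']; ring

/-! ### Euler products -/

/-- Euler's product for the cosine, along partial products. -/
theorem tendsto_euler_cos_prod {z : ℂ} (hz : Complex.sin (Real.pi * z) ≠ 0) :
    Tendsto (fun n : ℕ => ∏ k ∈ Finset.range n, (1 - 4 * z ^ 2 / (2 * (k : ℂ) + 1) ^ 2)) atTop
      (𝓝 (Complex.cos (Real.pi * z))) := by
  have h1 := Complex.tendsto_euler_sin_prod z
  have h2 := (Complex.tendsto_euler_sin_prod (2 * z)).comp
    (tendsto_id.const_mul_atTop' (show 0 < 2 by norm_num))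
  have hcos : Complex.cos (Real.pi * z)
      = Complex.sin (Real.pi * (2 * z)) / (2 * Complex.sin (Real.pi * z)) := by
    rw [show (Real.pi : ℂ) * (2 * z) = 2 * (Real.pi * z) by ring, Complex.sin_two_mul]
    field_simp
  rw [hcos]
  -- In the sine product at `2 * z`, the factors with even `j + 1` are those of the product at `z`;
  -- the odd ones make up the cosine product.
  have hsplit : ∀ n : ℕ, ∏ j ∈ Finset.range (2 * n), ((1 : ℂ) - (2 * z) ^ 2 / ((j : ℂ) + 1) ^ 2)
      = (∏ k ∈ Finset.range n, (1 - 4 * z ^ 2 / (2 * (k : ℂ) + 1) ^ 2))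
        * ∏ j ∈ Finset.range n, ((1 : ℂ) - z ^ 2 / ((j : ℂ) + 1) ^ 2) := by
    intro n
    induction n with
    | zero => simp
    | succ n ih =>
      rw [show 2 * (n + 1) = 2 * n + 1 + 1 by ring, Finset.prod_range_succ, Finset.prod_range_succ,
        ih, Finset.prod_range_succ, Finset.prod_range_succ]
      have e : (1 : ℂ) - (2 * z) ^ 2 / (((2 * n + 1 : ℕ) : ℂ) + 1) ^ 2
          = 1 - z ^ 2 / ((n : ℂ) + 1) ^ 2 := by
        have : (n : ℂ) + 1 ≠ 0 := Nat.cast_add_one_ne_zero n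
        push_cast
        rw [show (2 * (n : ℂ) + 1 + 1) = 2 * (n + 1) by ring]
        field_simp
      rw [e]
      push_cast
      ring
  refine (h2.div (h1.const_mul 2) (mul_ne_zero two_ne_zero hz)).congr' ?_
  filter_upwards [h1.eventually_ne hz] with n hn
  simp only [Function.comp_apply, id, Pi.div_apply]
  rw [hsplit]
  have h3 := left_ne_zero_of_mul hn
  have h4 := right_ne_zero_of_mul hn
  generalize ∏ j ∈ Finset.range n, (1 - z ^ 2 / ((j : ℂ) + 1) ^ 2) = q at h4
  rw [div_eq_iff (mul_ne_zero two_ne_zero (mul_ne_zero h3 h4))]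
  ring

/-- Euler's product for the hyperbolic cosine, along partial products. -/
theorem tendsto_euler_cosh_prod (t : ℝ) :
    Tendsto (fun n : ℕ => ∏ k ∈ Finset.range n,
      (1 + (t / ((2 * (k : ℝ) + 1) * Real.pi)) ^ 2)) atTop (𝓝 (Real.cosh (t / 2))) := by
  -- At `t = 0` the sine by which the cosine product was obtained vanishes.
  rcases eq_or_ne t 0 with rfl | ht
  · simp
  have hpi : (Real.pi : ℂ) ≠ 0 := by exact_mod_cast Real.pi_ne_zero
  set z : ℂ := ((t / (2 * Real.pi) : ℝ) : ℂ) * Complex.I with hz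
  have hpz : (Real.pi : ℂ) * z = ((t / 2 : ℝ) : ℂ) * Complex.I := by
    rw [hz]; push_cast; field_simp
  have hsin : Complex.sin (Real.pi * z) ≠ 0 := by
    rw [hpz, Complex.sin_mul_I, ← Complex.ofReal_sinh]
    refine mul_ne_zero ?_ Complex.I_ne_zero
    exact_mod_cast Real.sinh_ne_zero.mpr (by positivity)
  have h := tendsto_euler_cos_prod hsin
  rw [hpz, Complex.cos_mul_I, ← Complex.ofReal_cosh] at h
  have h' := (Complex.continuous_re.tendsto _).comp h
  rw [Complex.ofReal_re] at h'
  refine h'.congr fun n => ?_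
  rw [Function.comp_apply, ← Complex.ofReal_re (∏ k ∈ Finset.range n, _)]
  congr 1
  rw [Complex.ofReal_prod]
  refine Finset.prod_congr rfl fun k _ => ?_
  rw [hz, mul_pow, Complex.I_sq]
  push_cast
  have : 2 * (k : ℂ) + 1 ≠ 0 := by exact_mod_cast (Nat.succ_ne_zero (2 * k))
  field_simp
  ring

/-! ### Fourier transform of the hyperbolic secant -/

/-- The Fourier transform of the hyperbolic secant. -/
theorem integral_sech_smul_exp (t : ℝ) :
    ∫ x : ℝ, sech (Real.pi * x) • Complex.exp (t * x * Complex.I)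
      = ((1 / Real.cosh (t / 2) : ℝ) : ℂ) := by
  have hpi : (Real.pi : ℂ) ≠ 0 := by exact_mod_cast Real.pi_ne_zero
  set s : ℂ := 1 / 2 + ((t / (2 * Real.pi) : ℝ) : ℂ) * Complex.I with hs
  have hre : s.re = 1 / 2 := by rw [hs, Complex.add_re, Complex.re_ofReal_mul]; simp
  have hre' : (1 - s).re = 1 / 2 := by rw [Complex.sub_re, hre, Complex.one_re]; norm_num
  have hbeta : Complex.betaIntegral s (1 - s) = Real.pi / Real.cosh (t / 2) := by
    have h := Complex.Gamma_mul_Gamma_eq_betaIntegral (s := s) (t := 1 - s)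
      (by rw [hre]; norm_num) (by rw [hre']; norm_num)
    rw [Complex.Gamma_mul_Gamma_one_sub, add_sub_cancel, Complex.Gamma_one, one_mul] at h
    rw [← h]
    congr 1
    rw [show (Real.pi : ℂ) * s = ((t / 2 : ℝ) : ℂ) * Complex.I + Real.pi / 2 by
      rw [hs]; push_cast; field_simp; ring, Complex.sin_add_pi_div_two, Complex.cos_mul_I,
      Complex.ofReal_cosh]
  -- The substitution `u = σ x` carries the Beta integral from `(0, 1)` to the whole line.
  set σ : ℝ → ℝ := fun x => Real.sigmoid (2 * Real.pi * x) with hσ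
  have himage : σ '' Set.univ = Set.Ioo 0 1 := by
    rw [Set.image_univ, ← Real.range_sigmoid]
    exact (mul_left_surjective₀ Real.two_pi_pos.ne').range_comp Real.sigmoid
  have hderiv : ∀ x ∈ Set.univ, HasDerivWithinAt σ
      (Real.sigmoid (2 * Real.pi * x) * (1 - Real.sigmoid (2 * Real.pi * x)) * (2 * Real.pi))
      Set.univ x := by
    intro x _
    have := (Real.hasDerivAt_sigmoid (2 * Real.pi * x)).comp x
      ((hasDerivAt_id x).const_mul (2 * Real.pi))
    rw [mul_one] at this
    exact this.hasDerivWithinAt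
  have hinj : Set.InjOn σ Set.univ :=
    (Real.sigmoid_injective.comp (mul_right_injective₀ Real.two_pi_pos.ne')).injOn
  have hcv := integral_image_eq_integral_abs_deriv_smul MeasurableSet.univ hderiv hinj
    fun x : ℝ => (x : ℂ) ^ (s - 1) * (1 - (x : ℂ)) ^ (1 - s - 1)
  rw [himage, ← integral_Ioc_eq_integral_Ioo, ← intervalIntegral.integral_of_le zero_le_one,
    setIntegral_univ] at hcv
  change Complex.betaIntegral s (1 - s) = _ at hcv
  have hpt : ∀ x : ℝ, |Real.sigmoid (2 * Real.pi * x) * (1 - Real.sigmoid (2 * Real.pi * x))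
      * (2 * Real.pi)| • ((σ x : ℂ) ^ (s - 1) * (1 - (σ x : ℂ)) ^ (1 - s - 1))
      = Real.pi * (sech (Real.pi * x) • Complex.exp (t * x * Complex.I)) := by
    intro x
    set y := 2 * Real.pi * x with hy
    have p1 := Real.sigmoid_pos y
    have p2 : 0 < 1 - Real.sigmoid y := sub_pos.mpr (Real.sigmoid_lt_one y)
    -- This makes the powers collapse: the exponents of the sigmoid add up to `-1`, and `exp (-y)`
    -- to the power `-s` gives `exp (y * s)`.
    have hq : 1 - Real.sigmoid y = Real.sigmoid y * Real.exp (-y) := by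
      rw [Real.sigmoid_mul_rexp_neg, Real.sigmoid_neg]
    have hp : Real.sigmoid y = Real.exp (y / 2) / (2 * Real.cosh (Real.pi * x)) := by
      rw [Real.sigmoid_def, Real.cosh_eq, show Real.pi * x = y / 2 by rw [hy]; ring,
        show -y = -(y / 2) + -(y / 2) by ring, Real.exp_add]
      have := Real.exp_pos (y / 2)
      rw [Real.exp_neg]
      field_simp
    have hc : (0 : ℝ) < Real.cosh (Real.pi * x) := Real.cosh_pos _
    have h1 : (σ x : ℂ) = (Real.sigmoid y : ℂ) := rfl
    have n1 : (Real.sigmoid y : ℂ) ≠ 0 := by exact_mod_cast p1.ne'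
    have n2 : ((Real.exp (-y) : ℝ) : ℂ) ≠ 0 := by exact_mod_cast (Real.exp_pos _).ne'
    have hcpow : (σ x : ℂ) ^ (s - 1) * (1 - (σ x : ℂ)) ^ (1 - s - 1)
        = (Real.sigmoid y : ℂ)⁻¹ * Complex.exp (y * s) := by
      rw [h1, ← Complex.ofReal_one, ← Complex.ofReal_sub, hq, Complex.ofReal_mul,
        Complex.mul_cpow_ofReal_nonneg p1.le (Real.exp_pos _).le, ← mul_assoc,
        ← Complex.cpow_add _ _ n1, Complex.cpow_def_of_ne_zero n2, ← Complex.ofReal_log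
        (Real.exp_pos _).le, Real.log_exp, Complex.ofReal_one,
        show s - 1 + (1 - s - 1) = -1 by ring, Complex.cpow_neg_one]
      congr 2
      push_cast; ring
    rw [hcpow, abs_of_pos (by positivity), hq, Complex.real_smul, Complex.real_smul, sech]
    have : Complex.exp (y * s) = Real.exp (y / 2) * Complex.exp (t * x * Complex.I) := by
      rw [Complex.ofReal_exp, ← Complex.exp_add]
      congr 1
      rw [hs, hy]; push_cast; field_simp
    rw [this]
    have h3 : Real.sigmoid y * Real.exp (-y) * Real.exp (y / 2)
        = 1 / (2 * Real.cosh (Real.pi * x)) := by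
      rw [hp, mul_assoc, div_mul_eq_mul_div, ← Real.exp_add, ← Real.exp_add]
      ring_nf
      simp
    have h4 : ((Real.sigmoid y : ℝ) : ℂ) * (Real.exp (-y) : ℝ) * (Real.exp (y / 2) : ℝ)
        = ((1 / (2 * Real.cosh (Real.pi * x)) : ℝ) : ℂ) := by exact_mod_cast h3
    have n3 : (Real.cosh (Real.pi * x) : ℂ) ≠ 0 := by exact_mod_cast hc.ne'
    calc _ = 2 * Real.pi * (((Real.sigmoid y : ℝ) : ℂ) * (Real.exp (-y) : ℝ) *
          (Real.exp (y / 2) : ℝ)) * Complex.exp (t * x * Complex.I) := by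
          simp only [Complex.ofReal_mul, Complex.ofReal_ofNat]
          field_simp
      _ = _ := by
          rw [h4]
          simp only [Complex.ofReal_mul, Complex.ofReal_ofNat, Complex.ofReal_div,
            Complex.ofReal_one]
          field_simp
  simp_rw [hpt] at hcv
  rw [integral_const_mul, hbeta] at hcv
  refine mul_left_cancel₀ hpi (hcv.symm.trans ?_)
  push_cast
  ring

/-- The integral of a non-integrable function is `0` by convention, whereas the transform at `t = 0`
equals `1`. -/
theorem integrable_sech : Integrable fun x : ℝ => sech (Real.pi * x) := by
  have h := integral_sech_smul_exp 0
  simp only [Complex.ofReal_zero, zero_mul, Complex.exp_zero, Complex.real_smul, mul_one,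
    zero_div, Real.cosh_zero, div_one, Complex.ofReal_one] at h
  rw [integral_complex_ofReal] at h
  by_contra hn
  rw [integral_undef hn] at h
  simp at h

theorem measurable_sech : Measurable fun x : ℝ => sech (Real.pi * x) := by
  unfold sech
  fun_prop

theorem sech_nonneg (x : ℝ) : 0 ≤ sech x := one_div_nonneg.mpr (Real.cosh_pos x).le

instance isFiniteMeasure_sechMeasure : IsFiniteMeasure sechMeasure :=
  isFiniteMeasure_withDensity_ofReal integrable_sech.2

theorem charFun_sechMeasure (t : ℝ) :
    charFun sechMeasure t = ((1 / Real.cosh (t / 2) : ℝ) : ℂ) := by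
  rw [charFun_apply_real, sechMeasure, integral_withDensity_eq_integral_toReal_smul
    measurable_sech.ennreal_ofReal (by simp), ← integral_sech_smul_exp]
  refine integral_congr_ae (ae_of_all _ fun x => ?_)
  simp only [ENNReal.toReal_ofReal (sech_nonneg _)]

/-! ### Passage to the limit in law -/

/-- Almost sure convergence implies pointwise convergence of the characteristic functions. -/
theorem tendsto_charFun_map_of_ae_tendsto {Ω : Type*} [MeasurableSpace Ω] {P : Measure Ω}
    [IsFiniteMeasure P] {S : ℕ → Ω → ℝ} {Y : Ω → ℝ} (hS : ∀ n, AEMeasurable (S n) P)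
    (hY : AEMeasurable Y P) (h : ∀ᵐ ω ∂P, Tendsto (fun n => S n ω) atTop (𝓝 (Y ω))) (t : ℝ) :
    Tendsto (fun n => charFun (P.map (S n)) t) atTop (𝓝 (charFun (P.map Y) t)) := by
  have hmap : ∀ {Z : Ω → ℝ}, AEMeasurable Z P →
      charFun (P.map Z) t = ∫ ω, Complex.exp (t * Z ω * Complex.I) ∂P := fun hZ => by
    rw [charFun_apply_real, integral_map hZ (by fun_prop)]
  rw [hmap hY]
  simp_rw [hmap (hS _)]
  refine tendsto_integral_of_dominated_convergence (fun _ => 1) (fun n => ?_)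
    (integrable_const _) (fun n => ae_of_all _ fun ω => ?_) ?_
  · have : Continuous fun x : ℝ => Complex.exp (t * x * Complex.I) := by fun_prop
    exact (this.measurable.comp_aemeasurable (hS n)).aestronglyMeasurable
  · rw [← Complex.ofReal_mul, Complex.norm_exp_ofReal_mul_I]
  · filter_upwards [h] with ω hω
    have : Continuous fun x : ℝ => Complex.exp (t * x * Complex.I) := by fun_prop
    exact (this.tendsto _).comp hω

section Laplace

variable {Ω : Type*} [MeasurableSpace Ω] {P : Measure Ω} {L : ℕ → Ω → ℝ}

theorem iIndepFun.laplace_div (hindep : iIndepFun L P) :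
    iIndepFun (fun k ω => L k ω / ((2 * (k : ℝ) + 1) * Real.pi)) P :=
  hindep.comp (fun k x => x / ((2 * (k : ℝ) + 1) * Real.pi)) fun _ => by fun_prop

theorem ae_exists_tendsto_secantPartialSum [IsProbabilityMeasure P]
    (hlaw : ∀ k, HasLaw (L k) laplaceMeasure P)
    (hindep : iIndepFun L P) :
    ∀ᵐ ω ∂P, ∃ l : ℝ, Tendsto (fun n => secantPartialSum L n ω) atTop (𝓝 l) := by
  have hL : ∀ k, MemLp (L k) 2 P := fun k =>
    (HasLaw.id.identDistrib (hlaw k)).memLp_snd memLp_id_laplaceMeasure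
  refine ae_exists_tendsto_sum_of_summable_variance
    (X := fun k ω => L k ω / ((2 * (k : ℝ) + 1) * Real.pi)) (fun k => ?_) (fun k => ?_)
    (iIndepFun.laplace_div hindep) ?_
  · simpa only [div_eq_inv_mul] using (hL k).const_mul _
  · rw [integral_div, (hlaw k).integral_eq, integral_id_laplaceMeasure, zero_div]
  · have hvar : ∀ k, Var[fun ω => L k ω / ((2 * (k : ℝ) + 1) * Real.pi); P]
        = (1 / ((2 * (k : ℝ) + 1) * Real.pi)) ^ 2 * Var[id; laplaceMeasure] := fun k => by
      simp_rw [div_eq_inv_mul]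
      rw [variance_const_mul, (hlaw k).variance_eq, mul_one]
    simp_rw [hvar]
    refine Summable.mul_right _ ?_
    -- Comparison with `1 / (k + 1) ^ 2`, since `k + 1 ≤ (2 * k + 1) * π`.
    refine ((summable_nat_add_iff 1).mpr
      (Real.summable_one_div_nat_pow.mpr one_lt_two)).of_nonneg_of_le
      (fun k => by positivity) fun k => ?_
    rw [div_pow, one_pow]
    refine one_div_le_one_div_of_le (by positivity) (pow_le_pow_left₀ (by positivity) ?_ 2)
    push_cast
    nlinarith [Real.pi_gt_three, (Nat.cast_nonneg k : (0 : ℝ) ≤ k)]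

theorem charFun_map_secantPartialSum (hlaw : ∀ k, HasLaw (L k) laplaceMeasure P)
    (hindep : iIndepFun L P) (n : ℕ) (t : ℝ) :
    charFun (P.map (secantPartialSum L n)) t = (((∏ k ∈ Finset.range n,
      (1 + (t / ((2 * (k : ℝ) + 1) * Real.pi)) ^ 2))⁻¹ : ℝ) : ℂ) := by
  have h := iIndepFun.charFun_map_fun_finsetSum_eq_prod (s := Finset.range n)
    (fun k _ => (hlaw k).aemeasurable.div_const _) ((iIndepFun.laplace_div hindep).restrict _)
  change charFun (P.map (fun ω => ∑ k ∈ Finset.range n, L k ω / ((2 * (k : ℝ) + 1) * Real.pi))) t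
    = _
  rw [h, Finset.prod_apply, ← Finset.prod_inv_distrib, Complex.ofReal_prod]
  refine Finset.prod_congr rfl fun k _ => ?_
  simp_rw [div_eq_inv_mul]
  rw [charFun_map_mul_comp (hlaw k).aemeasurable, (hlaw k).map_eq, charFun_laplaceMeasure, one_div]

end Laplace

/-- For independent standard Laplace variables, the series `∑_{k ≥ 1} L_k / ((2 k - 1) π)`
converges almost surely (in the usual sense of partial sums; it does not converge absolutely), and
its sum `L₀` has density `sech (π x)`. -/
theorem mainTheorem2 {Ω : Type*} [MeasurableSpace Ω] (P : Measure Ω) [IsProbabilityMeasure P]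
    (L : ℕ → Ω → ℝ) (hlaw : ∀ k, HasLaw (L k) laplaceMeasure P) (hindep : iIndepFun L P) :
    (∀ᵐ ω ∂P, ∃ l : ℝ, Tendsto (fun n => secantPartialSum L n ω) atTop (𝓝 l)) ∧
    ∀ L₀ : Ω → ℝ,
      (∀ᵐ ω ∂P, Tendsto (fun n => secantPartialSum L n ω) atTop (𝓝 (L₀ ω))) →
        HasLaw L₀ sechMeasure P := by
  refine ⟨ae_exists_tendsto_secantPartialSum hlaw hindep, fun L₀ hL₀ => ?_⟩
  have hS : ∀ n, AEMeasurable (secantPartialSum L n) P := fun n =>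
    Finset.aemeasurable_fun_sum _ fun k _ => (hlaw k).aemeasurable.div_const _
  have hmeas : AEMeasurable L₀ P := aemeasurable_of_tendsto_metrizable_ae atTop hS hL₀
  refine ⟨hmeas, Measure.ext_of_charFun (funext fun t => ?_)⟩
  refine tendsto_nhds_unique (tendsto_charFun_map_of_ae_tendsto hS hmeas hL₀ t) ?_
  simp_rw [charFun_map_secantPartialSum hlaw hindep]
  rw [charFun_sechMeasure, one_div]
  exact (Complex.continuous_ofReal.tendsto _).comp
    ((tendsto_euler_cosh_prod t).inv₀ (Real.cosh_pos _).ne')
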